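/- Theorem 4.8. Let $n\ge 1$ and let $A=(a_{ij})$ be an indecomposable symmetric generalized $n\times n$ Cartan matrix, i.e., a symmetric integral matrix with $a_{ii}=2$ for all $i$ and $a_{ij}\le 0$ for all $i\ne j$ that is not conjugate under a permutation matrix to a block-diagonal matrix $\begin{pmatrix}A_1&0\\0&A_2\end{pmatrix}$ with square blocks $A_1,A_2$ of positive size. Let $e_1,\dots,e_n$ be the standard basis of $\mathbb{Z}^n$, let $\sigma_1,\dots,\sigma_n$ be the simple reflections of $\mathbb{Z}^n$, given by $\sigma_i(e_j)=e_j-a_{ij}e_i$ for all $i,j$, and let the Weyl group $\mathcal{W}$ be the subgroup of $GL(\mathbb{Z}^n)$ generated by $\sigma_1,\dots,\sigma_n$. For $w\in\mathcal{W}$ let $\ell(w)$ be the smallest integer $l\ge 0$ such that $w$ is a product of $l$ simple reflections. Let $v_1,\dots,v_n$ be any permutation of $1,\dots,n$ and let $c=\sigma_{v_n}\cdots\sigma_{v_1}$ be the corresponding Coxeter element. Then $\mathcal{W}$ is infinite if and only if $\ell(c^m)=|m|\,n$ for every $m\in\mathbb{Z}$. -/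

import Mathlib

namespace GCM

/-- Generalized Cartan matrices: integral, with `2` on the diagonal, nonpositive off the diagonal,
and with symmetric zero pattern. -/
structure IsGeneralizedCartan {n : ℕ} (A : Matrix (Fin n) (Fin n) ℤ) : Prop where
  diag : ∀ i, A i i = 2
  nonpos : ∀ i j, i ≠ j → A i j ≤ 0
  zero_symm : ∀ i j, A i j = 0 → A j i = 0

/-- `A` is indecomposable if it is not conjugate, under a permutation matrix, to a block-diagonal
matrix with two diagonal blocks of positive size. -/
def IsIndecomposable {n : ℕ} (A : Matrix (Fin n) (Fin n) ℤ) : Prop :=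
  ¬ ∃ (p q : ℕ) (_ : 0 < p) (_ : 0 < q) (e : Fin n ≃ Fin p ⊕ Fin q)
      (A₁ : Matrix (Fin p) (Fin p) ℤ) (A₂ : Matrix (Fin q) (Fin q) ℤ),
      Matrix.reindex e e A = Matrix.fromBlocks A₁ 0 0 A₂

variable {n : ℕ} {A : Matrix (Fin n) (Fin n) ℤ}

/-- The functional on `ℤⁿ` taking `e_j` to `A i j`. -/
def coroot (A : Matrix (Fin n) (Fin n) ℤ) (i : Fin n) : Module.Dual ℤ (Fin n → ℤ) :=
  (LinearMap.proj i).comp A.mulVecLin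

theorem coroot_single (A : Matrix (Fin n) (Fin n) ℤ) (i j : Fin n) :
    coroot A i (Pi.single j 1) = A i j := by
  simp [coroot]

theorem coroot_self (hA : IsGeneralizedCartan A) (i : Fin n) :
    coroot A i (Pi.single i 1) = 2 := by
  rw [coroot_single, hA.diag]

/-- The reflection `e_j ↦ e_j - A i j • e_i` of the root lattice `ℤⁿ`. -/
def reflection (hA : IsGeneralizedCartan A) (i : Fin n) : (Fin n → ℤ) ≃ₗ[ℤ] (Fin n → ℤ) :=
  Module.reflection (coroot_self hA i)

theorem reflection_single (hA : IsGeneralizedCartan A) (i j : Fin n) :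
    reflection hA i (Pi.single j 1) = Pi.single j 1 - A i j • Pi.single i 1 := by
  rw [reflection, Module.reflection_apply, coroot_single]

/-- The Weyl group: the group of automorphisms of `ℤⁿ` generated by the simple reflections. -/
def weylGroup (hA : IsGeneralizedCartan A) : Subgroup ((Fin n → ℤ) ≃ₗ[ℤ] (Fin n → ℤ)) :=
  Subgroup.closure (Set.range (reflection hA))

/-- The simple reflections as elements of the Weyl group. -/
def simple (hA : IsGeneralizedCartan A) (i : Fin n) : weylGroup hA :=
  ⟨reflection hA i, Subgroup.subset_closure ⟨i, rfl⟩⟩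

theorem simple_inv (hA : IsGeneralizedCartan A) (i : Fin n) :
    (simple hA i)⁻¹ = simple hA i := by
  apply Subtype.ext
  change (reflection hA i)⁻¹ = reflection hA i
  rw [inv_eq_iff_mul_eq_one]
  ext1 x
  exact Module.involutive_reflection (coroot_self hA i) x

/-- Every element of the Weyl group is a product of simple reflections. -/
theorem exists_word (hA : IsGeneralizedCartan A) (w : weylGroup hA) :
    ∃ l : ℕ, ∃ ω : List (Fin n), ω.length = l ∧ (ω.map (simple hA)).prod = w := by
  suffices h : ∃ ω : List (Fin n), (ω.map (simple hA)).prod = w by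
    obtain ⟨ω, h⟩ := h
    exact ⟨_, ω, rfl, h⟩
  obtain ⟨w, hw⟩ := w
  induction hw using Subgroup.closure_induction with
  | mem x hx =>
    obtain ⟨i, rfl⟩ := hx
    exact ⟨[i], by simp [simple]⟩
  | one => exact ⟨[], rfl⟩
  | mul x y hx hy ihx ihy =>
    obtain ⟨a, ha⟩ := ihx
    obtain ⟨b, hb⟩ := ihy
    refine ⟨a ++ b, ?_⟩
    rw [List.map_append, List.prod_append, ha, hb]
    rfl
  | inv x hx ih =>
    obtain ⟨a, ha⟩ := ih
    refine ⟨a.reverse, ?_⟩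
    have : (⟨x⁻¹, inv_mem hx⟩ : weylGroup hA) = (⟨x, hx⟩ : weylGroup hA)⁻¹ := rfl
    rw [this, ← ha, List.prod_inv_reverse, List.map_reverse, List.map_map]
    have h : (fun g => g⁻¹) ∘ simple hA = simple hA := funext (simple_inv hA)
    rw [h]

open Classical in
/-- The length of `w`: the least `l` such that `w` is a product of `l` simple reflections. -/
noncomputable def length (hA : IsGeneralizedCartan A) (w : weylGroup hA) : ℕ :=
  Nat.find (exists_word hA w)

/-- The Coxeter element `σ_{v_n} ⋯ σ_{v_1}` attached to an ordering `v_1, …, v_n` of the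
indices. -/
def coxeterElement (hA : IsGeneralizedCartan A) (v : Equiv.Perm (Fin n)) : weylGroup hA :=
  (List.ofFn fun k => simple hA (v k)).reverse.prod

end GCM

namespace GCM

variable {n : ℕ} {A : Matrix (Fin n) (Fin n) ℤ}

/-! If the Weyl group is finite, some power `c ^ k` with `k > 0` is trivial and has length `0 < k *
n`.

Suppose it is infinite. By the root criterion `length_mul_simple_of_nonneg`, appending `σ_j` to `w`
lengthens it whenever `w e_j ≥ 0`. So it suffices that `c ^ m β ≥ 0` for every `m : ℕ` and every
root `β = σ_{i_1} ⋯ σ_{i_k} e_j` attached to a prefix `i_1, …, i_k` of the word of `c`, with `j` the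
next letter.

The form `xᵀ A x` is not positive definite, since otherwise roots would be bounded integral vectors
and the group finite. A Perron–Frobenius argument then gives `u > 0` with `u A ≤ 0`
(`exists_pos_mul_nonpos`). Let `E` be the Euler form of the ordering. Then `E(x - c x, u) = u A x`
(`eulerPairing_sub_wordProd`), so `E(·, u)` does not decrease when `c` is applied to a nonnegative
vector. Also `E(β, u) = u_j > 0` for the prefix roots. If `c` sent a positive root `x` with `E(x, u)
> 0` to a negative one, then `c x` would be a nonpositive multiple of a prefix root. This would
force `E(c x, u) ≤ 0`, a contradiction. -/

theorem coroot_apply (A : Matrix (Fin n) (Fin n) ℤ) (i : Fin n) (x : Fin n → ℤ) :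
    coroot A i x = ∑ j, A i j * x j := by
  simp [coroot, Matrix.mulVec, dotProduct]

theorem simple_apply (hA : IsGeneralizedCartan A) (i : Fin n) (x : Fin n → ℤ) :
    (simple hA i).1 x = x - coroot A i x • Pi.single i 1 := by
  change reflection hA i x = _
  rw [reflection, Module.reflection_apply]

theorem simple_mul_self (hA : IsGeneralizedCartan A) (i : Fin n) :
    simple hA i * simple hA i = 1 := by
  rw [mul_eq_one_iff_eq_inv, simple_inv]

theorem simple_apply_self (hA : IsGeneralizedCartan A) (i : Fin n) :
    (simple hA i).1 (Pi.single i 1) = -Pi.single i 1 := by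
  rw [simple_apply, coroot_self hA, two_smul]
  abel

theorem simple_apply_of_ne (hA : IsGeneralizedCartan A) {i j : Fin n} (h : j ≠ i)
    (x : Fin n → ℤ) : (simple hA i).1 x j = x j := by
  simp [simple_apply, h]

theorem coe_mul_apply (hA : IsGeneralizedCartan A) (v w : weylGroup hA) (x : Fin n → ℤ) :
    (v * w).1 x = v.1 (w.1 x) := rfl

/-! ### The length function -/

theorem length_prod_le (hA : IsGeneralizedCartan A) (l : List (Fin n)) :
    length hA (l.map (simple hA)).prod ≤ l.length := by
  classical
  exact Nat.find_min' _ ⟨l, rfl, rfl⟩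

theorem exists_reduced_word (hA : IsGeneralizedCartan A) (w : weylGroup hA) :
    ∃ l : List (Fin n), l.length = length hA w ∧ (l.map (simple hA)).prod = w := by
  classical
  exact Nat.find_spec (exists_word hA w)

theorem length_one (hA : IsGeneralizedCartan A) : length hA 1 = 0 := by
  simpa using length_prod_le hA []

theorem length_mul_simple_le (hA : IsGeneralizedCartan A) (w : weylGroup hA) (i : Fin n) :
    length hA (w * simple hA i) ≤ length hA w + 1 := by
  obtain ⟨l, hl, rfl⟩ := exists_reduced_word hA w
  have := length_prod_le hA (l ++ [i])
  simpa [hl] using this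

theorem length_inv_le (hA : IsGeneralizedCartan A) (w : weylGroup hA) :
    length hA w⁻¹ ≤ length hA w := by
  obtain ⟨l, hl, hw⟩ := exists_reduced_word hA w
  have h : (fun g => g⁻¹) ∘ simple hA = simple hA := funext (simple_inv hA)
  have := length_prod_le hA l.reverse
  rw [List.length_reverse, hl] at this
  rwa [← hw, List.prod_inv_reverse, List.map_map, h, ← List.map_reverse, hw]

theorem length_inv (hA : IsGeneralizedCartan A) (w : weylGroup hA) :
    length hA w⁻¹ = length hA w :=
  le_antisymm (length_inv_le hA w) (by simpa using length_inv_le hA w⁻¹)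

theorem exists_descent (hA : IsGeneralizedCartan A) {w : weylGroup hA} (hw : w ≠ 1) :
    ∃ i, length hA (w * simple hA i) < length hA w := by
  obtain ⟨l, hl, h⟩ := exists_reduced_word hA w
  rcases List.eq_nil_or_concat l with rfl | ⟨l, i, rfl⟩
  · exact absurd (by simpa using h.symm) hw
  · refine ⟨i, ?_⟩
    rw [List.concat_eq_append] at h hl
    have h' : w * simple hA i = (l.map (simple hA)).prod := by
      simp [← h, mul_assoc, simple_mul_self]
    have := length_prod_le hA l
    rw [h']
    simp at hl
    omega

/-! ### Signs of real roots -/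

theorem simple_apply_single (hA : IsGeneralizedCartan A) (i j : Fin n) :
    (simple hA i).1 (Pi.single j 1) = Pi.single j 1 - A i j • Pi.single i 1 :=
  reflection_single hA i j

/-- Writes `w = (w σ_j) σ_j`, so that signs can be studied on `w σ_j`, which is shorter when `j` is
a descent. -/
theorem apply_single_eq (hA : IsGeneralizedCartan A) (w : weylGroup hA) (i j : Fin n) :
    w.1 (Pi.single i 1) =
      (w * simple hA j).1 (Pi.single i 1) - A j i • (w * simple hA j).1 (Pi.single j 1) := by
  rw [← map_smul, ← map_sub, ← simple_apply_single hA, ← coe_mul_apply, mul_assoc,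
    simple_mul_self, mul_one]

theorem simple_comm (hA : IsGeneralizedCartan A) {i j : Fin n} (h : A i j = 0) :
    simple hA i * simple hA j = simple hA j * simple hA i := by
  apply Subtype.ext
  apply LinearEquiv.ext
  intro x
  rw [coe_mul_apply, coe_mul_apply]
  simp only [simple_apply, map_sub, map_smul, coroot_single, h, hA.zero_symm i j h]
  module

theorem simple_braid (hA : IsGeneralizedCartan A) {i j : Fin n} (h : A i j = -1)
    (h' : A j i = -1) :
    simple hA i * simple hA j * simple hA i = simple hA j * simple hA i * simple hA j := by
  apply Subtype.ext
  apply LinearEquiv.ext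
  intro x
  simp only [coe_mul_apply]
  simp only [simple_apply, map_sub, map_smul, coroot_single, h, h', hA.diag]
  module

/-- Handles rank two subsystems with an infinite dihedral group. Stripping a descent `x` from `v`
swaps the roles of `x` and `y` and turns `(p, q)` into `(q, -A x y * q - p)`. The condition `p ≤ q`
survives because `-A x y ≥ 2`. -/
theorem nonneg_of_le_neg_two (hA : IsGeneralizedCartan A) {N : ℕ}
    (ih : ∀ v : weylGroup hA, length hA v ≤ N → ∀ i, length hA v ≤ length hA (v * simple hA i) →
      0 ≤ v.1 (Pi.single i 1)) :
    ∀ M ≤ N, ∀ (v : weylGroup hA) (x y : Fin n), length hA v = M → A x y ≤ -2 → A y x ≤ -2 →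
      length hA v ≤ length hA (v * simple hA y) → ∀ p q : ℤ, 0 ≤ p → p ≤ q →
      0 ≤ p • v.1 (Pi.single x 1) + q • v.1 (Pi.single y 1) := by
  intro M
  induction M using Nat.strong_induction_on with
  | _ M hM =>
    intro hMN v x y hv hxy hyx hy p q hp hpq
    by_cases hx : length hA v ≤ length hA (v * simple hA x)
    · exact add_nonneg (smul_nonneg hp (ih v (hv ▸ hMN) x hx))
        (smul_nonneg (hp.trans hpq) (ih v (hv ▸ hMN) y hy))
    · push Not at hx
      have key := hM _ (hv ▸ hx) (by omega) (v * simple hA x) y x rfl hyx hxy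
        (by rw [mul_assoc, simple_mul_self, mul_one]; exact hx.le) q (-A x y * q - p)
        (hp.trans hpq) (by nlinarith)
      rw [apply_single_eq hA v x x, apply_single_eq hA v y x, hA.diag]
      convert key using 1
      module

/-- If multiplying `w` on the right by the `i`-th simple reflection does not decrease its length,
then `w` takes the `i`-th simple root to a nonnegative vector. -/
theorem apply_single_nonneg (hA : IsGeneralizedCartan A) (hsymm : A.IsSymm) :
    ∀ (w : weylGroup hA) (i : Fin n), length hA w ≤ length hA (w * simple hA i) →
      0 ≤ w.1 (Pi.single i 1) := by
  suffices H : ∀ (N : ℕ) (w : weylGroup hA), length hA w ≤ N → ∀ i : Fin n,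
      length hA w ≤ length hA (w * simple hA i) → 0 ≤ w.1 (Pi.single i 1) from
    fun w => H _ w le_rfl
  intro N
  induction N with
  | zero =>
    intro w hw i _
    obtain ⟨l, hl, h⟩ := exists_reduced_word hA w
    obtain rfl : l = [] := List.eq_nil_of_length_eq_zero (by omega)
    obtain rfl : w = 1 := by simpa using h.symm
    exact Pi.single_nonneg.2 zero_le_one
  | succ N ih =>
    intro w hw i hi
    rcases eq_or_ne w 1 with rfl | hw1
    · exact Pi.single_nonneg.2 zero_le_one
    obtain ⟨j, hj⟩ := exists_descent hA hw1
    have hij : i ≠ j := by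
      rintro rfl
      omega
    have hA' : A j i = A i j := hsymm.apply i j
    obtain ⟨v, rfl⟩ : ∃ v, w = v * simple hA j :=
      ⟨w * simple hA j, by rw [mul_assoc, simple_mul_self, mul_one]⟩
    rw [mul_assoc v, simple_mul_self, mul_one] at hj
    have hvj := length_mul_simple_le hA v j
    rw [apply_single_eq hA _ i j, mul_assoc v, simple_mul_self, mul_one]
    have hvjpos : 0 ≤ v.1 (Pi.single j 1) := ih v (by omega) j hj.le
    have hneg := hA.nonpos i j hij
    rw [hA']
    obtain h0 | h1 | h2 : A i j = 0 ∨ A i j = -1 ∨ A i j ≤ -2 := by omega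
    · rw [h0, zero_smul, sub_zero]
      -- If `i` were a descent of `v`, then `w σ_i = v σ_i σ_j` would be shorter than `w`.
      refine ih v (by omega) i ?_
      by_contra! hvi
      have := length_mul_simple_le hA (v * simple hA i) j
      rw [mul_assoc, simple_comm hA h0, ← mul_assoc] at this
      omega
    · by_cases hvi : length hA v ≤ length hA (v * simple hA i)
      · rw [h1, neg_smul, one_smul, sub_neg_eq_add]
        exact add_nonneg (ih v (by omega) i hvi) hvjpos
      · push Not at hvi
        obtain ⟨v, rfl⟩ : ∃ v', v = v' * simple hA i :=
          ⟨v * simple hA i, by rw [mul_assoc, simple_mul_self, mul_one]⟩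
        rw [mul_assoc v, simple_mul_self, mul_one] at hvi
        -- Now `w = v σ_i σ_j` and `w e_i = v e_j`. A descent `j` of `v` would, by the braid
        -- relation, make `w σ_i` shorter than `w`.
        have key : 0 ≤ v.1 (Pi.single j 1) := by
          refine ih v (by omega) j ?_
          by_contra! hvj'
          have e : v * simple hA i * simple hA j * simple hA i =
              v * simple hA j * simple hA i * simple hA j := by
            have := simple_braid hA h1 (hA'.trans h1)
            simp only [mul_assoc] at this ⊢
            rw [this]
          rw [e] at hi
          have h3 := length_mul_simple_le hA (v * simple hA j * simple hA i) j
          have h4 := length_mul_simple_le hA (v * simple hA j) i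
          have h5 := length_mul_simple_le hA v i
          omega
        convert key using 1
        rw [coe_mul_apply, coe_mul_apply, simple_apply_self, simple_apply_single, h1, map_neg]
        simp
    · have := nonneg_of_le_neg_two hA ih (length hA v) (by omega) v i j rfl h2 (hA' ▸ h2) hj.le
        1 (-A i j) zero_le_one (by omega)
      convert this using 1
      module

theorem nonneg_or_nonpos (hA : IsGeneralizedCartan A) (hsymm : A.IsSymm) (w : weylGroup hA)
    (i : Fin n) : 0 ≤ w.1 (Pi.single i 1) ∨ w.1 (Pi.single i 1) ≤ 0 := by
  rcases le_total (length hA w) (length hA (w * simple hA i)) with h | h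
  · exact .inl (apply_single_nonneg hA hsymm w i h)
  · right
    have := apply_single_nonneg hA hsymm (w * simple hA i) i
      (by rwa [mul_assoc, simple_mul_self, mul_one])
    rw [coe_mul_apply, simple_apply_self, map_neg] at this
    exact neg_nonneg.1 this

theorem apply_single_ne_zero (hA : IsGeneralizedCartan A) (w : weylGroup hA) (i : Fin n) :
    w.1 (Pi.single i 1) ≠ 0 := by
  simp

/-- Otherwise the sign criterion for `w σ_i` makes `w e_i` nonpositive as well, hence zero. No
parity argument is needed. -/
theorem length_mul_simple_of_nonneg (hA : IsGeneralizedCartan A) (hsymm : A.IsSymm)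
    (w : weylGroup hA) (i : Fin n) (h : 0 ≤ w.1 (Pi.single i 1)) :
    length hA (w * simple hA i) = length hA w + 1 := by
  refine le_antisymm (length_mul_simple_le hA w i) ?_
  by_contra! hlt
  have := apply_single_nonneg hA hsymm (w * simple hA i) i
    (by rw [mul_assoc, simple_mul_self, mul_one]; omega)
  rw [coe_mul_apply, simple_apply_self, map_neg] at this
  exact apply_single_ne_zero hA w i (le_antisymm (neg_nonneg.1 this) h)

/-! ### The Euler functional of an ordering -/

/-- The product of simple reflections attached to a word. -/
def wordProd (hA : IsGeneralizedCartan A) (l : List (Fin n)) : weylGroup hA :=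
  (l.map (simple hA)).prod

@[simp]
theorem wordProd_nil (hA : IsGeneralizedCartan A) : wordProd hA [] = 1 := rfl

@[simp]
theorem wordProd_cons (hA : IsGeneralizedCartan A) (i : Fin n) (l : List (Fin n)) :
    wordProd hA (i :: l) = simple hA i * wordProd hA l := by
  simp [wordProd]

@[simp]
theorem wordProd_append (hA : IsGeneralizedCartan A) (l l' : List (Fin n)) :
    wordProd hA (l ++ l') = wordProd hA l * wordProd hA l' := by
  simp [wordProd]

/-- The pairing `x ↦ E(x, u)` with respect to the Euler form `E` of the orientation of the Dynkin
diagram attached to the ordering `l` of its vertices. -/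
def eulerPairing (A : Matrix (Fin n) (Fin n) ℤ) (u : Fin n → ℝ) :
    List (Fin n) → (Fin n → ℤ) → ℝ
  | [], _ => 0
  | i :: l, x => u i * ((x i : ℝ) + (l.map fun j => (A i j * x j : ℝ)).sum) + eulerPairing A u l x

theorem eulerPairing_congr (u : Fin n → ℝ) {l : List (Fin n)} {x y : Fin n → ℤ}
    (h : ∀ i ∈ l, x i = y i) : eulerPairing A u l x = eulerPairing A u l y := by
  induction l with
  | nil => rfl
  | cons i l ih =>
    have hl : l.map (fun j => (A i j * x j : ℝ)) = l.map fun j => (A i j * y j : ℝ) :=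
      List.map_congr_left fun j hj => by rw [h j (by simp [hj])]
    rw [eulerPairing, eulerPairing, ih fun j hj => h j (by simp [hj]), h i (by simp), hl]

theorem eulerPairing_zero (u : Fin n → ℝ) (l : List (Fin n)) : eulerPairing A u l 0 = 0 := by
  induction l with
  | nil => rfl
  | cons i l ih => simp [eulerPairing, ih]

theorem eulerPairing_sub (u : Fin n → ℝ) (l : List (Fin n)) (x y : Fin n → ℤ) :
    eulerPairing A u l (x - y) = eulerPairing A u l x - eulerPairing A u l y := by
  induction l with
  | nil => simp [eulerPairing]
  | cons i l ih =>
    have : (l.map fun j => (A i j * (x - y) j : ℝ)).sum =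
        (l.map fun j => (A i j * x j : ℝ)).sum - (l.map fun j => (A i j * y j : ℝ)).sum := by
      clear ih
      induction l with
      | nil => simp
      | cons j l ih' =>
        rw [List.map_cons, List.sum_cons, ih', Pi.sub_apply]
        simp only [List.map_cons, List.sum_cons]
        push_cast
        ring
    rw [eulerPairing, this, ih, Pi.sub_apply, eulerPairing, eulerPairing]
    push_cast
    ring

theorem eulerPairing_smul (u : Fin n → ℝ) (l : List (Fin n)) (m : ℤ) (x : Fin n → ℤ) :
    eulerPairing A u l (m • x) = m * eulerPairing A u l x := by
  induction l with
  | nil => simp [eulerPairing]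
  | cons i l ih =>
    have : (l.map fun j => (A i j * (m • x) j : ℝ)).sum =
        m * (l.map fun j => (A i j * x j : ℝ)).sum := by
      rw [← List.sum_map_mul_left]
      congr 1
      refine List.map_congr_left fun j _ => ?_
      simp only [Pi.smul_apply, smul_eq_mul]
      push_cast
      ring
    rw [eulerPairing, this, ih, Pi.smul_apply, smul_eq_mul, eulerPairing]
    push_cast
    ring

theorem wordProd_apply_of_notMem (hA : IsGeneralizedCartan A) {l : List (Fin n)} {j : Fin n}
    (hj : j ∉ l) (x : Fin n → ℤ) : (wordProd hA l).1 x j = x j := by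
  induction l with
  | nil => rfl
  | cons i l ih =>
    rw [List.mem_cons, not_or] at hj
    rw [wordProd_cons, coe_mul_apply, simple_apply_of_ne hA hj.1, ih hj.2]

theorem sum_map_eq_coroot {l : List (Fin n)} (hl : l.Nodup) (i : Fin n) {x : Fin n → ℤ}
    (hx : ∀ j ∉ l, x j = 0) :
    (l.map fun j => (A i j * x j : ℝ)).sum = (coroot A i x : ℝ) := by
  rw [coroot_apply, ← List.sum_toFinset _ hl]
  push_cast
  refine Finset.sum_subset (Finset.subset_univ _) fun j _ hj => ?_
  rw [hx j (by simpa using hj)]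
  simp

/-- A new first letter `i` changes only coordinate `i` of `x - y`, where `y` is the image of `x`
under the remaining word. That coordinate becomes `coroot A i y`, and the later letters contribute
`coroot A i (x - y)`. -/
theorem eulerPairing_sub_wordProd (hA : IsGeneralizedCartan A) (u : Fin n → ℝ)
    {l : List (Fin n)} (hl : l.Nodup) (x : Fin n → ℤ) :
    eulerPairing A u l (x - (wordProd hA l).1 x) = (l.map fun i => u i * (coroot A i x : ℝ)).sum := by
  induction l with
  | nil => rfl
  | cons i l ih =>
    obtain ⟨hi, hl⟩ := List.nodup_cons.1 hl
    set y := (wordProd hA l).1 x with hy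
    have hyj : ∀ j ∉ l, (x - y) j = 0 := fun j hj => by
      simp [hy, wordProd_apply_of_notMem hA hj]
    have e : x - (wordProd hA (i :: l)).1 x = x - y + coroot A i y • Pi.single i 1 := by
      rw [wordProd_cons, coe_mul_apply, simple_apply, ← hy]
      abel
    have hne : ∀ j ∈ l, (x - (wordProd hA (i :: l)).1 x) j = (x - y) j := fun j hj => by
      have : j ≠ i := fun h => hi (h ▸ hj)
      rw [e]
      simp [this]
    have hself : (x - (wordProd hA (i :: l)).1 x) i = coroot A i y := by
      rw [e, Pi.add_apply, hyj i hi]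
      simp
    have hl' : (l.map fun j => (A i j * (x - (wordProd hA (i :: l)).1 x) j : ℝ)) =
        l.map fun j => (A i j * (x - y) j : ℝ) :=
      List.map_congr_left fun j hj => by rw [hne j hj]
    rw [eulerPairing, hl', sum_map_eq_coroot hl i hyj, hself, eulerPairing_congr u hne, ih hl,
      List.map_cons, List.sum_cons, map_sub]
    push_cast
    ring

theorem eulerPairing_single_of_notMem (u : Fin n → ℝ) {l : List (Fin n)} {j : Fin n}
    (hj : j ∉ l) : eulerPairing A u l (Pi.single j 1) = 0 := by
  rw [← eulerPairing_zero (A := A) u l]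
  refine eulerPairing_congr u fun i hi => ?_
  have : i ≠ j := fun h => hj (h ▸ hi)
  simp [this]

/-- Letters before `j` contribute nothing: the coordinate created by `σ_i` cancels the sum over the
later letters. Letters after `j` have zero coordinates, so only `u j` remains. -/
theorem eulerPairing_wordProd_single (hA : IsGeneralizedCartan A) (u : Fin n → ℝ)
    {a b : List (Fin n)} {j : Fin n} (hl : (a ++ j :: b).Nodup) :
    eulerPairing A u (a ++ j :: b) ((wordProd hA a).1 (Pi.single j 1)) = u j := by
  induction a with
  | nil =>
    have hj : j ∉ b := (List.nodup_cons.1 hl).1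
    have hb : (b.map fun k => (A j k * (Pi.single j 1 : Fin n → ℤ) k : ℝ)).sum = 0 := by
      refine List.sum_eq_zero fun r hr => ?_
      obtain ⟨k, hk, rfl⟩ := List.mem_map.1 hr
      have : k ≠ j := fun h => hj (h ▸ hk)
      simp [this]
    change eulerPairing A u (j :: b) (Pi.single j 1) = u j
    rw [eulerPairing, hb, eulerPairing_single_of_notMem u hj]
    simp
  | cons i a ih =>
    rw [List.cons_append] at hl ⊢
    obtain ⟨hi, hl⟩ := List.nodup_cons.1 hl
    set z := (wordProd hA a).1 (Pi.single j 1) with hz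
    have hzj : ∀ k ∉ a ++ j :: b, z k = 0 := fun k hk => by
      simp only [List.mem_append, List.mem_cons, not_or] at hk
      simp [hz, wordProd_apply_of_notMem hA hk.1, hk.2.1]
    have hne : ∀ k ∈ a ++ j :: b, (simple hA i).1 z k = z k := fun k hk =>
      simple_apply_of_ne hA (fun h : k = i => hi (h ▸ hk)) z
    have hself : (simple hA i).1 z i = -coroot A i z := by
      simp [simple_apply, hzj i hi]
    have hl' : ((a ++ j :: b).map fun k => (A i k * (simple hA i).1 z k : ℝ)) =
        (a ++ j :: b).map fun k => (A i k * z k : ℝ) :=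
      List.map_congr_left fun k hk => by rw [hne k hk]
    rw [wordProd_cons, coe_mul_apply, ← hz, eulerPairing, hl', sum_map_eq_coroot hl i hzj, hself,
      eulerPairing_congr u hne, ih hl]
    push_cast
    ring

/-! ### Positivity along powers of a Coxeter element -/

/-- A vector whose sign is changed by a simple reflection is a multiple of the simple root. -/
theorem eq_smul_single_of_simple_nonpos (hA : IsGeneralizedCartan A) {i : Fin n}
    {x : Fin n → ℤ} (hx : 0 ≤ x) (hsx : (simple hA i).1 x ≤ 0) : x = x i • Pi.single i 1 := by
  ext j
  rcases eq_or_ne j i with rfl | h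
  · simp
  · have := hsx j
    rw [simple_apply_of_ne hA h] at this
    simpa [h] using le_antisymm this (hx j)

/-- If the word `l` makes a positive root negative, the image is a negative multiple of one of the
roots attached to the prefixes of `l`. -/
theorem exists_split_of_wordProd_nonpos (hA : IsGeneralizedCartan A) (hsymm : A.IsSymm)
    (l : List (Fin n)) (w : weylGroup hA) (i : Fin n) (hw : 0 ≤ w.1 (Pi.single i 1))
    (hlw : (wordProd hA l * w).1 (Pi.single i 1) ≤ 0) :
    ∃ a j b, ∃ m : ℤ, l = a ++ j :: b ∧ 0 ≤ m ∧
      (wordProd hA l * w).1 (Pi.single i 1) = -m • (wordProd hA a).1 (Pi.single j 1) := by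
  induction l with
  | nil =>
    rw [wordProd_nil, one_mul] at hlw
    exact absurd (le_antisymm hlw hw) (apply_single_ne_zero hA w i)
  | cons k l ih =>
    rw [wordProd_cons, mul_assoc] at hlw
    -- Either the sign changes exactly at `k`, and the prefix is empty, or it has already changed
    -- within `l`.
    rcases nonneg_or_nonpos hA hsymm (wordProd hA l * w) i with h | h
    · rw [coe_mul_apply] at hlw
      refine ⟨[], k, l, (wordProd hA l * w).1 (Pi.single i 1) k, rfl, h k, ?_⟩
      rw [wordProd_cons, mul_assoc, coe_mul_apply]
      conv_lhs => rw [eq_smul_single_of_simple_nonpos hA h hlw, map_smul, simple_apply_self]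
      rw [smul_neg, neg_smul]
      rfl
    · obtain ⟨a, j, b, m, rfl, hm, e⟩ := ih h
      refine ⟨k :: a, j, b, m, rfl, hm, ?_⟩
      rw [wordProd_cons, mul_assoc, coe_mul_apply, e, map_smul, wordProd_cons, coe_mul_apply]

theorem wordProd_apply_single_nonneg (hA : IsGeneralizedCartan A) (hsymm : A.IsSymm)
    {a : List (Fin n)} {j : Fin n} (hj : j ∉ a) : 0 ≤ (wordProd hA a).1 (Pi.single j 1) := by
  refine (nonneg_or_nonpos hA hsymm _ j).resolve_right fun h => ?_
  have := h j
  rw [wordProd_apply_of_notMem hA hj] at this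
  simp at this

/-- Positivity of the Euler pairing is carried through the induction because it is what excludes a
change of sign at the next application of the Coxeter element. -/
theorem wordProd_pow_apply_single_nonneg (hA : IsGeneralizedCartan A) (hsymm : A.IsSymm)
    {u : Fin n → ℝ} (hu : ∀ i, 0 < u i) (hAu : ∀ j, ∑ i, u i * (A i j : ℝ) ≤ 0)
    {a b : List (Fin n)} {j : Fin n} (hl : (a ++ j :: b).Nodup) (hmem : ∀ i, i ∈ a ++ j :: b)
    (m : ℕ) :
    0 ≤ (wordProd hA (a ++ j :: b) ^ m * wordProd hA a).1 (Pi.single j 1) ∧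
      0 < eulerPairing A u (a ++ j :: b)
        ((wordProd hA (a ++ j :: b) ^ m * wordProd hA a).1 (Pi.single j 1)) := by
  set l := a ++ j :: b with hldef
  induction m with
  | zero =>
    rw [pow_zero, one_mul, hldef, eulerPairing_wordProd_single hA u hl]
    refine ⟨wordProd_apply_single_nonneg hA hsymm fun h => ?_, hu j⟩
    exact (List.nodup_append.1 hl).2.2 j h j (by simp) rfl
  | succ m ih =>
    obtain ⟨hpos, hE⟩ := ih
    rw [pow_succ', mul_assoc]
    set w := wordProd hA l ^ m * wordProd hA a
    set x := w.1 (Pi.single j 1) with hx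
    have hf : (l.map fun i => u i * (coroot A i x : ℝ)).sum ≤ 0 := by
      rw [← List.sum_toFinset _ hl, show l.toFinset = Finset.univ by ext i; simp [hmem i]]
      have : ∑ i, u i * (coroot A i x : ℝ) = ∑ k, (x k : ℝ) * ∑ i, u i * (A i k : ℝ) := by
        simp only [coroot_apply, Finset.mul_sum]
        push_cast
        simp only [Finset.mul_sum]
        rw [Finset.sum_comm]
        exact Finset.sum_congr rfl fun _ _ => Finset.sum_congr rfl fun _ _ => by ring
      rw [this]
      exact Finset.sum_nonpos fun k _ =>
        mul_nonpos_of_nonneg_of_nonpos (by exact_mod_cast hpos k) (hAu k)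
    rw [← eulerPairing_sub_wordProd hA u hl, eulerPairing_sub] at hf
    have hE' : 0 < eulerPairing A u l ((wordProd hA l * w).1 (Pi.single j 1)) := by
      rw [coe_mul_apply, ← hx]
      linarith
    refine ⟨(nonneg_or_nonpos hA hsymm _ j).resolve_right fun h => ?_, hE'⟩
    obtain ⟨a', j', b', k, e, hk, hlw⟩ :=
      exists_split_of_wordProd_nonpos hA hsymm l w j hpos h
    rw [hlw, eulerPairing_smul, e, eulerPairing_wordProd_single hA u (e ▸ hl)] at hE'
    have : (0 : ℝ) ≤ k * u j' := mul_nonneg (by exact_mod_cast hk) (hu j').le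
    push_cast at hE'
    linarith

theorem length_wordProd_pow (hA : IsGeneralizedCartan A) (hsymm : A.IsSymm)
    {u : Fin n → ℝ} (hu : ∀ i, 0 < u i) (hAu : ∀ j, ∑ i, u i * (A i j : ℝ) ≤ 0)
    {l : List (Fin n)} (hl : l.Nodup) (hmem : ∀ i, i ∈ l) (m : ℕ) :
    length hA (wordProd hA l ^ m) = m * l.length := by
  induction m with
  | zero => simp [length_one]
  | succ m ih =>
    -- The next copy of `l` is appended one letter at a time, each letter adding one to the length.
    suffices H : ∀ a b, a ++ b = l →
        length hA (wordProd hA l ^ m * wordProd hA a) = m * l.length + a.length by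
      rw [pow_succ, H l [] (by simp)]
      ring
    intro a
    induction a using List.reverseRecOn with
    | nil => simp [ih]
    | append_singleton a j iha =>
      intro b hb
      rw [List.append_assoc, List.singleton_append] at hb
      have := (wordProd_pow_apply_single_nonneg hA hsymm hu hAu (hb ▸ hl) (hb ▸ hmem) m).1
      rw [hb] at this
      rw [wordProd_append, wordProd_cons, wordProd_nil, mul_one, ← mul_assoc,
        length_mul_simple_of_nonneg hA hsymm _ j this, iha _ hb]
      simp [add_assoc]

/-! ### Infinite Weyl groups and subharmonic vectors -/

/-- Listing `S` before its complement makes `A` block-diagonal; symmetry kills the second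
off-diagonal block. -/
theorem IsIndecomposable.eq_univ (hind : IsIndecomposable A) (hsymm : A.IsSymm)
    {S : Set (Fin n)} (hS : S.Nonempty) (h : ∀ i ∈ S, ∀ j ∉ S, A i j = 0) : S = Set.univ := by
  classical
  by_contra hne
  obtain ⟨k, hk⟩ := (Set.ne_univ_iff_exists_notMem S).1 hne
  obtain ⟨s, hs⟩ := hS
  let e : Fin n ≃ Fin (Fintype.card {i // i ∈ S}) ⊕ Fin (Fintype.card {i // i ∉ S}) :=
    (Equiv.sumCompl (· ∈ S)).symm.trans
      (Equiv.sumCongr (Fintype.equivFin _) (Fintype.equivFin _))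
  refine hind ⟨_, _, Fintype.card_pos_iff.2 ⟨⟨s, hs⟩⟩, Fintype.card_pos_iff.2 ⟨⟨k, hk⟩⟩, e,
    (Matrix.reindex e e A).toBlocks₁₁, (Matrix.reindex e e A).toBlocks₂₂, ?_⟩
  ext (i | i) (j | j)
  · rfl
  · exact h _ ((Fintype.equivFin {i // i ∈ S}).symm i).2 _
      ((Fintype.equivFin {i // i ∉ S}).symm j).2
  · change A _ _ = 0
    rw [hsymm.apply]
    exact h _ ((Fintype.equivFin {i // i ∈ S}).symm j).2 _
      ((Fintype.equivFin {i // i ∉ S}).symm i).2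
  · rfl

/-- The quadratic form `x ↦ xᵀ A x` on `ℝⁿ`. -/
def quadForm (A : Matrix (Fin n) (Fin n) ℤ) (x : Fin n → ℝ) : ℝ :=
  ∑ i, ∑ j, (A i j : ℝ) * (x i * x j)

theorem quadForm_smul (A : Matrix (Fin n) (Fin n) ℤ) (r : ℝ) (x : Fin n → ℝ) :
    quadForm A (r • x) = r ^ 2 * quadForm A x := by
  simp only [quadForm, Finset.mul_sum]
  refine Finset.sum_congr rfl fun i _ => Finset.sum_congr rfl fun j _ => ?_
  simp only [Pi.smul_apply, smul_eq_mul]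
  ring

/-- Off-diagonal entries are nonpositive and `x i * x j ≤ |x i| * |x j|`. Hence a minimiser may be
replaced by its absolute value. -/
theorem quadForm_abs_le (hA : IsGeneralizedCartan A) (x : Fin n → ℝ) :
    quadForm A (fun i => |x i|) ≤ quadForm A x := by
  refine Finset.sum_le_sum fun i _ => Finset.sum_le_sum fun j _ => ?_
  rcases eq_or_ne i j with rfl | h
  · rw [abs_mul_abs_self]
  · refine mul_le_mul_of_nonpos_left ?_ (by exact_mod_cast hA.nonpos i j h)
    rw [← abs_mul]
    exact le_abs_self _

/-- The Rayleigh quotient of the quadratic form attains its minimum. -/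
theorem exists_isMin_quadForm (hn : 0 < n) (A : Matrix (Fin n) (Fin n) ℤ) :
    ∃ x : Fin n → ℝ, ∑ i, x i ^ 2 = 1 ∧
      ∀ y : Fin n → ℝ, quadForm A x * ∑ i, y i ^ 2 ≤ quadForm A y := by
  let K : Set (Fin n → ℝ) := {x | ∑ i, x i ^ 2 = 1}
  have hK : IsCompact K := by
    refine (isCompact_Icc (a := (-1 : Fin n → ℝ)) (b := 1)).of_isClosed_subset
      (isClosed_eq (by fun_prop) continuous_const) fun x hx => ?_
    have h : ∀ i, |x i| ≤ 1 := fun i => by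
      rw [← sq_le_one_iff_abs_le_one, ← show ∑ i, x i ^ 2 = 1 from hx]
      exact Finset.single_le_sum (f := fun i => x i ^ 2) (fun j _ => sq_nonneg _)
        (Finset.mem_univ i)
    exact ⟨fun i => (abs_le.1 (h i)).1, fun i => (abs_le.1 (h i)).2⟩
  have hne : K.Nonempty := by
    refine ⟨Pi.single ⟨0, hn⟩ 1, ?_⟩
    change ∑ i, (Pi.single ⟨0, hn⟩ 1 : Fin n → ℝ) i ^ 2 = 1
    rw [Finset.sum_eq_single ⟨0, hn⟩] <;> simp +contextual
  obtain ⟨x, hx, hmin⟩ := hK.exists_isMinOn hne (f := quadForm A)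
    (by unfold quadForm; fun_prop)
  refine ⟨x, hx, fun y => ?_⟩
  have hs : 0 ≤ ∑ i, y i ^ 2 := Finset.sum_nonneg fun i _ => sq_nonneg _
  rcases hs.eq_or_lt with h0 | hpos
  · have hy : y = 0 := by
      ext i
      have := (Finset.sum_eq_zero_iff_of_nonneg fun i _ => sq_nonneg (y i)).1 h0.symm i
        (Finset.mem_univ i)
      simpa using this
    simp [hy, quadForm]
  · set r := Real.sqrt (∑ i, y i ^ 2)
    have hr : 0 < r := Real.sqrt_pos.2 hpos
    have hr2 : r ^ 2 = ∑ i, y i ^ 2 := Real.sq_sqrt hs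
    have hmem : r⁻¹ • y ∈ K := by
      change ∑ i, (r⁻¹ • y) i ^ 2 = 1
      simp only [Pi.smul_apply, smul_eq_mul, mul_pow, ← Finset.mul_sum, ← hr2]
      field_simp
    have h : quadForm A x ≤ quadForm A (r⁻¹ • y) := hmin hmem
    rw [quadForm_smul, inv_pow, ← div_eq_inv_mul, le_div_iff₀ (by positivity), hr2] at h
    exact h

/-! ### Invariance of the form and finiteness in the definite case -/

theorem quadForm_intCast (A : Matrix (Fin n) (Fin n) ℤ) (x : Fin n → ℤ) :
    quadForm A (fun i => (x i : ℝ)) = ((∑ i, x i * coroot A i x : ℤ) : ℝ) := by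
  simp only [quadForm, coroot_apply, Finset.mul_sum]
  push_cast
  exact Finset.sum_congr rfl fun _ _ => Finset.sum_congr rfl fun _ _ => by ring

theorem sum_mul_coroot_comm (hsymm : A.IsSymm) (x y : Fin n → ℤ) :
    ∑ i, x i * coroot A i y = ∑ i, y i * coroot A i x := by
  simp only [coroot_apply, Finset.mul_sum]
  rw [Finset.sum_comm]
  refine Finset.sum_congr rfl fun i _ => Finset.sum_congr rfl fun j _ => ?_
  rw [hsymm.apply]
  ring

theorem sum_mul_coroot_simple (hA : IsGeneralizedCartan A) (hsymm : A.IsSymm) (k : Fin n)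
    (x : Fin n → ℤ) :
    ∑ i, (simple hA k).1 x i * coroot A i ((simple hA k).1 x) = ∑ i, x i * coroot A i x := by
  have hs : ∀ y : Fin n → ℤ, ∑ i, (Pi.single k 1 : Fin n → ℤ) i * coroot A i y = coroot A k y :=
    fun y => by rw [Finset.sum_eq_single k] <;> simp +contextual
  have hs' : ∑ i, x i * coroot A i (Pi.single k 1) = coroot A k x := by
    rw [sum_mul_coroot_comm hsymm, hs]
  have hsub : ∀ i, (simple hA k).1 x i * coroot A i ((simple hA k).1 x) =
      x i * coroot A i x - coroot A k x * (x i * coroot A i (Pi.single k 1)) -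
        coroot A k x * ((Pi.single k 1 : Fin n → ℤ) i * coroot A i ((simple hA k).1 x)) := by
    intro i
    rw [simple_apply, map_sub, map_smul]
    simp only [Pi.sub_apply, Pi.smul_apply, smul_eq_mul]
    ring
  simp only [hsub, Finset.sum_sub_distrib, ← Finset.mul_sum, hs, hs']
  rw [simple_apply, map_sub, map_smul, coroot_self hA, smul_eq_mul]
  ring

theorem sum_mul_coroot_apply (hA : IsGeneralizedCartan A) (hsymm : A.IsSymm) (w : weylGroup hA)
    (x : Fin n → ℤ) : ∑ i, w.1 x i * coroot A i (w.1 x) = ∑ i, x i * coroot A i x := by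
  obtain ⟨l, -, rfl⟩ := exists_reduced_word hA w
  induction l with
  | nil => rfl
  | cons k l ih =>
    rw [List.map_cons, List.prod_cons, coe_mul_apply, sum_mul_coroot_simple hA hsymm, ih]

/-- If the quadratic form is positive definite, then the Weyl group is finite. -/
theorem finite_weylGroup (hA : IsGeneralizedCartan A) (hsymm : A.IsSymm) {r : ℝ} (hr : 0 < r)
    (h : ∀ y : Fin n → ℝ, r * ∑ i, y i ^ 2 ≤ quadForm A y) : Finite (weylGroup hA) := by
  -- Roots have form value `2`, hence squared norm at most `2 / r`; integrality gives `|x i| ≤ x i ^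
  -- 2 ≤ M`.
  obtain ⟨M, hM⟩ := exists_nat_ge (2 / r)
  have hbound : ∀ (w : weylGroup hA) (k : Fin n),
      w.1 (Pi.single k 1) ∈ Set.Icc (fun _ => -M : Fin n → ℤ) (fun _ => M) := by
    intro w k
    set x := w.1 (Pi.single k 1) with hx
    have hq : ∑ i, x i * coroot A i x = 2 := by
      rw [hx, sum_mul_coroot_apply hA hsymm,
        Finset.sum_eq_single k] <;> simp +contextual [coroot_self hA]
    have h2 := h fun i => (x i : ℝ)
    rw [quadForm_intCast, hq] at h2
    have hi : ∀ i, |x i| ≤ M := fun i => by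
      have h3 : (x i : ℝ) ^ 2 ≤ ∑ i, (x i : ℝ) ^ 2 :=
        Finset.single_le_sum (f := fun i => (x i : ℝ) ^ 2) (fun j _ => sq_nonneg _)
          (Finset.mem_univ i)
      have h4 : (x i : ℝ) ^ 2 ≤ M := by
        refine le_trans ?_ hM
        rw [le_div_iff₀ hr]
        push_cast at h2
        nlinarith
      have h5 : x i ^ 2 ≤ M := by exact_mod_cast h4
      rw [← sq_abs] at h5
      have := Int.le_self_sq |x i|
      exact this.trans h5
    exact ⟨fun i => (abs_le.1 (hi i)).1, fun i => (abs_le.1 (hi i)).2⟩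
  have : Finite (Set.Icc (fun _ => -M : Fin n → ℤ) (fun _ => M)) := Set.finite_Icc _ _
  refine Finite.of_injective
    (fun (w : weylGroup hA) (k : Fin n) => (⟨_, hbound w k⟩ : Set.Icc _ _)) fun w w' hw => ?_
  apply Subtype.ext
  apply LinearEquiv.toLinearMap_injective
  refine LinearMap.pi_ext' fun k => LinearMap.ext_ring ?_
  exact congrArg Subtype.val (congrFun hw k)

/-- If the Weyl group of an indecomposable symmetric generalized Cartan matrix `A` is infinite,
then there is a vector `u` with positive coordinates such that `u A` has nonpositive coordinates. -/
theorem exists_pos_mul_nonpos (hn : 0 < n) (hA : IsGeneralizedCartan A) (hsymm : A.IsSymm)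
    (hind : IsIndecomposable A) [Infinite (weylGroup hA)] :
    ∃ u : Fin n → ℝ, (∀ i, 0 < u i) ∧ ∀ j, ∑ i, u i * (A i j : ℝ) ≤ 0 := by
  obtain ⟨x, hx, hmin⟩ := exists_isMin_quadForm hn A
  set r := quadForm A x
  have hr : r ≤ 0 := by
    by_contra! hr
    exact not_finite_iff_infinite.2 ‹_› (finite_weylGroup hA hsymm hr hmin)
  -- Since `r` is the minimum of the Rayleigh quotient, `A - r` is positive semidefinite. Its form
  -- vanishes at `|x|`, so `|x|` lies in its kernel.
  let M : Matrix (Fin n) (Fin n) ℝ := A.map (Int.cast : ℤ → ℝ) - r • 1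
  have hMq : ∀ y, y ⬝ᵥ M.mulVec y = quadForm A y - r * ∑ i, y i ^ 2 := by
    intro y
    have h1 : y ⬝ᵥ y = ∑ i, y i ^ 2 := by simp [dotProduct, sq]
    have h2 : y ⬝ᵥ (A.map (Int.cast : ℤ → ℝ)).mulVec y = quadForm A y := by
      simp only [dotProduct, Matrix.mulVec, quadForm, Finset.mul_sum, Matrix.map_apply]
      exact Finset.sum_congr rfl fun _ _ => Finset.sum_congr rfl fun _ _ => by ring
    rw [Matrix.sub_mulVec, dotProduct_sub, Matrix.smul_mulVec, Matrix.one_mulVec,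
      dotProduct_smul, h1, h2, smul_eq_mul]
  have hMsymm : M.IsHermitian := by
    ext i j
    simp [M, Matrix.one_apply, hsymm.apply i j, eq_comm]
  have hM : M.PosSemidef := .of_dotProduct_mulVec_nonneg hMsymm fun y => by
    rw [star_trivial, hMq]
    linarith [hmin y]
  let u : Fin n → ℝ := fun i => |x i|
  have hu1 : ∑ i, u i ^ 2 = 1 := by simpa [u] using hx
  have hMu : M.mulVec u = 0 := by
    rw [← hM.dotProduct_mulVec_zero_iff, star_trivial, hMq, hu1]
    have h1 : quadForm A u ≤ r := quadForm_abs_le hA x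
    have h2 := hmin u
    rw [hu1] at h2
    linarith
  have hAu : ∀ j, ∑ i, u i * (A i j : ℝ) = r * u j := by
    intro j
    have := congrFun hMu j
    rw [Matrix.sub_mulVec, Matrix.smul_mulVec, Matrix.one_mulVec] at this
    have h1 : (A.map (Int.cast : ℤ → ℝ)).mulVec u j = r * u j := by
      simpa [sub_eq_zero] using this
    rw [← h1, Matrix.mulVec, dotProduct]
    exact Finset.sum_congr rfl fun i _ => by rw [Matrix.map_apply, hsymm.apply, mul_comm]
  have hu0 : ∀ i, 0 ≤ u i := fun i => abs_nonneg _
  -- If `u j = 0`, the terms `u k * A k j` are nonpositive with sum zero, so `A i j = 0` for all `i`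
  -- in the support of `u`.
  have hS : {i | u i ≠ 0} = Set.univ := by
    refine hind.eq_univ hsymm ?_ fun i hi j hj => ?_
    · by_contra! h
      have : ∀ i, u i = 0 := fun i => by
        by_contra hi
        exact (Set.eq_empty_iff_forall_notMem.1 h) i hi
      simp [this] at hu1
    · have hj : u j = 0 := not_not.1 hj
      have hsum := hAu j
      rw [hj, mul_zero] at hsum
      have hle : ∀ k ∈ Finset.univ, u k * (A k j : ℝ) ≤ 0 := fun k _ => by
        rcases eq_or_ne k j with rfl | hkj
        · simp [hj]
        · exact mul_nonpos_of_nonneg_of_nonpos (hu0 k) (by exact_mod_cast hA.nonpos k j hkj)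
      have := (Finset.sum_eq_zero_iff_of_nonpos hle).1 hsum i (Finset.mem_univ i)
      simpa using (mul_eq_zero.1 this).resolve_left hi
  refine ⟨u, fun i => (hu0 i).lt_of_ne' (Set.eq_univ_iff_forall.1 hS i), fun j => ?_⟩
  rw [hAu]
  exact mul_nonpos_of_nonpos_of_nonneg hr (hu0 j)

/-! ### Powers of Coxeter elements -/

theorem coxeterElement_eq_wordProd (hA : IsGeneralizedCartan A) (v : Equiv.Perm (Fin n)) :
    coxeterElement hA v = wordProd hA (List.ofFn v).reverse := by
  rw [coxeterElement, wordProd, List.map_reverse, List.map_ofFn]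
  rfl

/-- Powers of a Coxeter element of an infinite Weyl group are reduced. -/
theorem length_coxeterElement_pow (hn : 0 < n) (hA : IsGeneralizedCartan A) (hsymm : A.IsSymm)
    (hind : IsIndecomposable A) [Infinite (weylGroup hA)] (v : Equiv.Perm (Fin n)) (m : ℕ) :
    length hA (coxeterElement hA v ^ m) = m * n := by
  obtain ⟨u, hu, hAu⟩ := exists_pos_mul_nonpos hn hA hsymm hind
  rw [coxeterElement_eq_wordProd, length_wordProd_pow hA hsymm hu hAu]
  · simp
  · exact List.nodup_reverse.2 (List.nodup_ofFn.2 v.injective)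
  · intro i
    rw [List.mem_reverse, List.mem_ofFn]
    exact v.surjective i

end GCM

theorem theorem4p8 {n : ℕ} (hn : 0 < n) (A : Matrix (Fin n) (Fin n) ℤ)
    (hA : GCM.IsGeneralizedCartan A) (hsymm : A.IsSymm) (hind : GCM.IsIndecomposable A)
    (v : Equiv.Perm (Fin n)) :
    Infinite (GCM.weylGroup hA) ↔
      ∀ m : ℤ, (GCM.length hA (GCM.coxeterElement hA v ^ m) : ℤ) = |m| * (n : ℤ) := by
  constructor
  · intro _ m
    obtain ⟨k, rfl | rfl⟩ := m.eq_nat_or_neg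
    · rw [zpow_natCast, GCM.length_coxeterElement_pow hn hA hsymm hind]
      simp
    · rw [zpow_neg, zpow_natCast, GCM.length_inv,
        GCM.length_coxeterElement_pow hn hA hsymm hind]
      simp
  · intro h
    by_contra hfin
    rw [not_infinite_iff_finite] at hfin
    obtain ⟨k, hk, hck⟩ := isOfFinOrder_iff_pow_eq_one.1
      (isOfFinOrder_of_finite (GCM.coxeterElement hA v))
    have := h k
    rw [zpow_natCast, hck, GCM.length_one] at this
    have hpos : 0 < (k : ℤ) * n := by positivity
    simp at this
    omega
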